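/- All graphs are finite and simple. An interval graph is an intersection graph of nonempty intervals of the real line, and a circular arc graph is an intersection graph of nonempty arcs of a circle (two distinct vertices are adjacent if and only if the corresponding sets meet). For an edge-coloring of a graph $G$, a path in $G$ is called proper if no two adjacent edges of the path have the same color. For a connected graph $G$, the proper connection number $\mathrm{pc}(G)$ is the minimum number of colors used in an edge-coloring of $G$ for which every two distinct vertices of $G$ are joined by a proper path. Theorem. (i) Let $G$ be a connected interval graph or a connected circular arc graph with minimum degree $\delta(G)\ge 2$. Then $\mathrm{pc}(G)\le 3$. (ii) The bound is sharp for both classes, infinitely often: for every $N$ there is a connected interval graph $G$ with at least $N$ vertices, $\delta(G)\ge 2$ and $\mathrm{pc}(G)=3$; and for every $N$ there is a connected circular arc graph $G$ that is not an interval graph, with at least $N$ vertices, $\delta(G)\ge 2$ and $\mathrm{pc}(G)=3$. -/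

import Mathlib

namespace ProperConnection

/-- A path `p` is proper for the edge-colouring `c` when it is a path (no repeated vertex) and
any two adjacent (that is, consecutive) edges of `p` have different colours. -/
def IsProperPath {V : Type*} {G : SimpleGraph V} (c : Sym2 V → ℕ) {u v : V}
    (p : G.Walk u v) : Prop :=
  p.IsPath ∧ p.edges.IsChain (fun e f => c e ≠ c f)

/-- The edge-colouring `c` is a proper-path colouring of `G`: any two distinct vertices are joined
by a proper path. Colours are natural numbers; only the values of `c` on the edges of `G` are ever
used. -/
def IsProperPathColoring {V : Type*} (G : SimpleGraph V) (c : Sym2 V → ℕ) : Prop :=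
  ∀ u v : V, u ≠ v → ∃ p : G.Walk u v, IsProperPath c p

/-- The proper connection number `pc(G)`: the least number of colours used on the edges of `G` by
a proper-path colouring of `G` (it is `⊤` if there is no such colouring). -/
noncomputable def pc {V : Type*} (G : SimpleGraph V) : ℕ∞ :=
  ⨅ c ∈ {c : Sym2 V → ℕ | IsProperPathColoring G c}, (c '' G.edgeSet).encard

/-- `G` is an intersection graph of sets taken from the family `F`: its vertices can be mapped to
members of `F` so that two distinct vertices are adjacent exactly when their sets meet. -/
def IsIntersectionGraph {V α : Type*} (G : SimpleGraph V) (F : Set (Set α)) : Prop :=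
  ∃ S : V → Set α, (∀ v, S v ∈ F) ∧
    ∀ u v, G.Adj u v ↔ u ≠ v ∧ (S u ∩ S v).Nonempty

/-- The nonempty intervals of the real line (open, closed or half-open, bounded or not). -/
def realIntervals : Set (Set ℝ) :=
  {I | I.Nonempty ∧ I.OrdConnected}

/-- The nonempty arcs of the circle `ℝ / ℤ`: the images of the nonempty intervals of the real line
under the covering map. -/
def circleArcs : Set (Set UnitAddCircle) :=
  {A | ∃ I ∈ realIntervals, A = (fun x : ℝ => (x : UnitAddCircle)) '' I}

/-- Interval graphs. -/
def IsIntervalGraph {V : Type*} (G : SimpleGraph V) : Prop :=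
  IsIntersectionGraph G realIntervals

/-- Circular arc graphs. -/
def IsCircularArcGraph {V : Type*} (G : SimpleGraph V) : Prop :=
  IsIntersectionGraph G circleArcs

end ProperConnection

/-!
Everything off a suitable path can be attached to it. Suppose a graph represented by sets has a
path `P` whose sets cover the union of all the sets. Then every vertex `u` off `P` has a neighbour
on `P`. If it has only one, `x`, then the set of `u` lies inside that of `x`; as `u` has degree at
least two it has a neighbour off `P`, and every such neighbour is adjacent to `x`.

Let `B` be the set of vertices off `P` with exactly one neighbour on `P`, let `M` be a maximal
independent subset of `B`, and let `L = B \ M`. The edges of `P` are coloured `0, 1, 0, 1, …`, those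
between `L` and `P` get `0`, the others between `P` and its complement get `2`, and all edges off `P`
get `1`. Every vertex off `P` can then reach `P` by an edge of colour `2`, a vertex of `L` doing so
through a neighbour in `M`; such an exit continues along `P` and leaves it again by a second exit.
Exits with a common end on `P` are treated separately, with colour `0` at the vertices of `L`, or by
a detour through another vertex of `P` (`isProperPathColoring_of_dominating`,
`pc_le_three_of_covering_path`).

A covering path exists in a connected interval graph: a path from a leftmost interval to a rightmost
one. For arcs, consider all the lifts of the arcs to the line. If two different lifts of one vertex
are connected in their intersection graph, then a shortest walk of this kind covers a whole period
and projects to a covering path; otherwise a connected component contains exactly one lift of each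
vertex, and the graph is an interval graph (`pc_le_three_of_isCircularArcGraph`).

For sharpness, let three triangles share a vertex `p`, their other vertices having no further
neighbours. With two colours each triangle has a vertex from which `p` can be reached with one last
colour only. For two of the triangles these colours agree, and no proper path joins the two vertices
(`three_le_pc`). One long interval or arc containing many points provides such triangles; three more
arcs closing an induced four-cycle around the circle prevent the graph from being an interval graph.
-/

namespace ProperConnection

variable {V : Type*} {G : SimpleGraph V}

/-! ### Gluing proper paths -/

theorem IsProperPath.reverse {c : Sym2 V → ℕ} {u v : V} {p : G.Walk u v} (h : IsProperPath c p) :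
    IsProperPath c p.reverse := by
  refine ⟨h.1.reverse, ?_⟩
  rw [SimpleGraph.Walk.edges_reverse, List.isChain_reverse]
  exact h.2.imp fun _ _ h => h.symm

/-- `Joined G c S u v α β`: some nontrivial proper path from `u` to `v` stays inside `S`, its first
edge has colour `α` and its last edge has colour `β`. -/
def Joined (G : SimpleGraph V) (c : Sym2 V → ℕ) (S : Set V) (u v : V) (α β : ℕ) : Prop :=
  ∃ w : G.Walk u v, w.IsPath ∧ (w.edges.map c).IsChain (· ≠ ·) ∧ (∀ x ∈ w.support, x ∈ S) ∧
    (w.edges.map c).head? = some α ∧ (w.edges.map c).getLast? = some β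

namespace Joined

variable {c : Sym2 V → ℕ} {S T : Set V} {u v w : V} {α β γ δ : ℕ}

theorem exists_isProperPath (h : Joined G c S u v α β) :
    ∃ p : G.Walk u v, IsProperPath c p := by
  obtain ⟨p, hp, hc, -⟩ := h
  exact ⟨p, hp, (List.isChain_map c).1 hc⟩

theorem of_adj (h : G.Adj u v) (hα : c s(u, v) = α) : Joined G c {u, v} u v α α := by
  subst hα
  exact ⟨h.toWalk, by simp [SimpleGraph.Walk.cons_isPath_iff, h.ne], by simp, by simp, by simp,
    by simp⟩

theorem symm (h : Joined G c S u v α β) : Joined G c S v u β α := by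
  obtain ⟨p, hp, hc, hS, h₁, h₂⟩ := h
  refine ⟨p.reverse, hp.reverse, ?_, by simpa using hS, by simpa using h₂, by simpa using h₁⟩
  rw [SimpleGraph.Walk.edges_reverse, List.map_reverse, List.isChain_reverse]
  exact hc.imp fun _ _ h => h.symm

theorem trans (h : Joined G c S u v α β) (h' : Joined G c T v w γ δ) (hST : S ∩ T ⊆ {v})
    (hβγ : β ≠ γ) : Joined G c (S ∪ T) u w α δ := by
  obtain ⟨p, hp, hc, hS, h₁, h₂⟩ := h
  obtain ⟨q, hq, hd, hT, h₃, h₄⟩ := h'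
  refine ⟨p.append q, ?_, ?_, ?_, ?_, ?_⟩
  · rw [SimpleGraph.Walk.isPath_def, SimpleGraph.Walk.support_append, List.nodup_append']
    refine ⟨hp.support_nodup, hq.support_nodup.tail, fun x hx hx' => ?_⟩
    have hxv : x = v := hST ⟨hS x hx, hT x (List.mem_of_mem_tail hx')⟩
    have := hq.support_nodup
    rw [← q.cons_tail_support, List.nodup_cons] at this
    exact this.1 (hxv ▸ hx')
  · rw [SimpleGraph.Walk.edges_append, List.map_append, List.isChain_append]
    refine ⟨hc, hd, ?_⟩
    simp only [h₂, h₃]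
    simpa using hβγ
  · intro x hx
    rw [SimpleGraph.Walk.mem_support_append_iff] at hx
    exact hx.imp (hS x) (hT x)
  · simp [h₁]
  · simp [h₄]

theorem mono (h : Joined G c S u v α β) (hST : S ⊆ T) : Joined G c T u v α β := by
  obtain ⟨p, hp, hc, hS, h⟩ := h
  exact ⟨p, hp, hc, fun x hx => hST (hS x hx), h⟩

end Joined

/-- Along a path `p 0, …, p k` whose edges are coloured by parity, every section is proper. -/
theorem joined_of_alternating {c : Sym2 V → ℕ} {p : ℕ → V} {k : ℕ} (hinj : Set.InjOn p (Set.Iic k))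
    (hadj : ∀ i < k, G.Adj (p i) (p (i + 1))) (hc : ∀ i < k, c s(p i, p (i + 1)) = i % 2)
    (i d : ℕ) (hd : i + d + 1 ≤ k) :
    Joined G c (p '' Set.Icc i (i + d + 1)) (p i) (p (i + d + 1)) (i % 2) ((i + d) % 2) := by
  induction d with
  | zero =>
    refine (Joined.of_adj (hadj i (by omega)) (hc i (by omega))).mono ?_
    rintro x (rfl | rfl)
    · exact ⟨i, by simp, rfl⟩
    · exact ⟨i + 1, by simp, rfl⟩
  | succ d ih =>
    refine ((ih (by omega)).trans (Joined.of_adj (hadj (i + d + 1) (by omega))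
      (hc _ (by omega))) ?_ (by omega)).mono ?_
    · rintro x ⟨⟨j, hj, rfl⟩, h | h⟩
      · exact h
      · have hj' := Set.mem_Icc.1 hj
        have := hinj (Set.mem_Iic.2 (by omega)) (Set.mem_Iic.2 (by omega)) h
        omega
    · rintro x (⟨j, hj, rfl⟩ | rfl | rfl)
      · exact ⟨j, ⟨hj.1, by have := hj.2; omega⟩, rfl⟩
      · exact ⟨i + d + 1, ⟨by omega, by omega⟩, rfl⟩
      · exact ⟨i + d + 1 + 1, ⟨by omega, by omega⟩, rfl⟩

theorem joined_of_alternating_of_ne {c : Sym2 V → ℕ} {p : ℕ → V} {k : ℕ}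
    (hinj : Set.InjOn p (Set.Iic k)) (hadj : ∀ i < k, G.Adj (p i) (p (i + 1)))
    (hc : ∀ i < k, c s(p i, p (i + 1)) = i % 2) {x y : V} (hx : x ∈ p '' Set.Iic k)
    (hy : y ∈ p '' Set.Iic k) (hxy : x ≠ y) :
    ∃ α < 2, ∃ β < 2, Joined G c (p '' Set.Iic k) x y α β := by
  obtain ⟨i, hi, rfl⟩ := hx
  obtain ⟨j, hj, rfl⟩ := hy
  have hmono : ∀ a b, b ≤ k → p '' Set.Icc a b ⊆ p '' Set.Iic k := fun a b hb =>
    Set.image_mono fun t ht => le_trans ht.2 hb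
  simp only [Set.mem_Iic] at hi hj
  rcases lt_or_gt_of_ne (show i ≠ j from fun h => hxy (h ▸ rfl)) with h | h
  · obtain ⟨d, rfl⟩ := Nat.exists_eq_add_of_lt h
    exact ⟨_, Nat.mod_lt _ two_pos, _, Nat.mod_lt _ two_pos,
      (joined_of_alternating hinj hadj hc i d hj).mono (hmono _ _ hj)⟩
  · obtain ⟨d, rfl⟩ := Nat.exists_eq_add_of_lt h
    exact ⟨_, Nat.mod_lt _ two_pos, _, Nat.mod_lt _ two_pos,
      (joined_of_alternating hinj hadj hc j d hi).symm.mono (hmono _ _ hi)⟩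

/-! ### A colouring with three colours -/

/-- A colouring in which the path vertices `P` are already joined by proper paths of colours `0` and
`1` at their ends, edges off `P` have colour `1`, and edges between `P` and its complement have
colour `0` at the vertices of `L` and colour `2` at the others.  Here `B` is the set of vertices
having a single neighbour in `P`, and `B \ L` is a maximal independent subset of `B`. -/
theorem isProperPathColoring_of_dominating {c : Sym2 V → ℕ} {P B L : Set V}
    (hP : ∀ x ∈ P, ∀ y ∈ P, x ≠ y → ∃ α < 2, ∃ β < 2, Joined G c P x y α β)
    (hdom : ∀ u ∉ P, ∃ x ∈ P, G.Adj u x)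
    (hB : ∀ u, u ∈ B ↔ u ∉ P ∧ ∀ x ∈ P, ∀ y ∈ P, G.Adj u x → G.Adj u y → x = y)
    (htri : ∀ u ∈ B, (∃ w ∉ P, G.Adj u w) ∧ ∀ x ∈ P, ∀ w ∉ P, G.Adj u x → G.Adj u w → G.Adj w x)
    (hLB : L ⊆ B)
    (hind : ∀ u ∈ B \ L, ∀ v ∈ B \ L, ¬ G.Adj u v)
    (hmax : ∀ u ∈ L, ∃ m ∈ B \ L, G.Adj u m)
    (hc₁ : ∀ u ∉ P, ∀ v ∉ P, c s(u, v) = 1)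
    (hc₀ : ∀ u ∈ L, ∀ x ∈ P, c s(u, x) = 0)
    (hc₂ : ∀ u ∉ L, u ∉ P → ∀ x ∈ P, c s(u, x) = 2) :
    IsProperPathColoring G c := by
  have hBP : ∀ u ∈ B, u ∉ P := fun u hu => ((hB u).1 hu).1
  have hLP : ∀ u ∈ L, u ∉ P := fun u hu => hBP u (hLB hu)
  have hne : ∀ {u x}, u ∉ P → x ∈ P → u ≠ x := fun hu hx h => hu (h ▸ hx)
  -- Every vertex off `P` reaches `P` through a last edge of colour `2`.
  have hN : ∀ u ∉ P, u ∉ L → ∀ x ∈ P, G.Adj u x → Joined G c {u, x} u x 2 2 :=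
    fun u hu hu' x hx h => Joined.of_adj h (hc₂ u hu' hu x hx)
  have hL : ∀ u ∈ L, ∃ m ∈ B \ L, ∃ x ∈ P, G.Adj u m ∧ G.Adj u x ∧ G.Adj m x ∧
      Joined G c {u, m, x} u x 1 2 := by
    intro u hu
    obtain ⟨m, hm, hum⟩ := hmax u hu
    obtain ⟨x, hx, hux⟩ := hdom u (hLP u hu)
    have hmP := hBP m hm.1
    have hmx := (htri u (hLB hu)).2 x hx m hmP hux hum
    refine ⟨m, hm, x, hx, hum, hux, hmx, ?_⟩
    refine ((Joined.of_adj hum (hc₁ u (hLP u hu) m hmP)).trans (hN m hmP hm.2 x hx hmx) ?_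
      (by decide)).mono ?_
    · have h1 := hne (hLP u hu) hx
      rintro y ⟨rfl | rfl, h | h⟩
      · exact h
      · exact absurd h h1
      · rfl
      · rfl
    · rintro y ((rfl | rfl) | (rfl | rfl)) <;> simp
  have hexit : ∀ u ∉ P, ∃ x ∈ P, ∃ T : Set V, T ∩ P ⊆ {x} ∧ ∃ α, Joined G c T u x α 2 := by
    intro u hu
    by_cases huL : u ∈ L
    · obtain ⟨m, hm, x, hx, -, -, -, hj⟩ := hL u huL
      refine ⟨x, hx, _, ?_, _, hj⟩
      rintro y ⟨rfl | rfl | rfl, h⟩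
      · exact absurd h hu
      · exact absurd h (hBP _ hm.1)
      · rfl
    · obtain ⟨x, hx, hux⟩ := hdom u hu
      refine ⟨x, hx, _, ?_, _, hN u hu huL x hx hux⟩
      rintro y ⟨rfl | rfl, h⟩
      · exact absurd h hu
      · rfl
  -- Two exits with different ends on `P` are connected through `P`.
  have hglue : ∀ {u v x y S T} {α β}, x ∈ P → y ∈ P → x ≠ y → S ∩ P ⊆ {x} → T ∩ P ⊆ {y} →
      Disjoint S T → Joined G c S u x α 2 → Joined G c T v y β 2 →
      ∃ p : G.Walk u v, IsProperPath c p := by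
    intro u v x y S T α β hx hy hxy hS hT hST h₁ h₂
    obtain ⟨a, ha, b, hb, h⟩ := hP x hx y hy hxy
    refine Joined.exists_isProperPath (S := S ∪ P ∪ T) (α := α) (β := β)
      ((h₁.trans h hS (by omega)).trans h₂.symm ?_ (by omega))
    rintro z ⟨hz | hz, hz'⟩
    · exact absurd hz' (Set.disjoint_left.1 hST hz)
    · exact hT ⟨hz', hz⟩
  have hPoff : ∀ u ∉ P, ∀ y ∈ P, ∃ p : G.Walk u y, IsProperPath c p := by
    intro u hu y hy
    obtain ⟨x, hx, T, hT, α, h⟩ := hexit u hu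
    by_cases hxy : x = y
    · subst hxy; exact h.exists_isProperPath
    · obtain ⟨a, ha, b, hb, h'⟩ := hP x hx y hy hxy
      exact (h.trans h' hT (by omega)).exists_isProperPath
  have hrev : ∀ {u v}, (∃ p : G.Walk u v, IsProperPath c p) →
      ∃ p : G.Walk v u, IsProperPath c p := by
    rintro u v ⟨p, hp⟩
    exact ⟨p.reverse, hp.reverse⟩
  have hpair : ∀ {u x}, u ∉ P → ({u, x} : Set V) ∩ P ⊆ {x} := by
    rintro u x hu z ⟨rfl | rfl, hz⟩
    · exact absurd hz hu
    · rfl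
  have hLN : ∀ u ∈ L, ∀ v ∉ P, v ∉ L → ¬ G.Adj u v → u ≠ v →
      ∃ p : G.Walk u v, IsProperPath c p := by
    intro u hu v hv hvL huv huv'
    -- A common end on `P` is left with colour `0` towards `u`; otherwise `u` goes through `m`.
    obtain ⟨m, hm, x, hx, hum, hux, hmx, hj⟩ := hL u hu
    have hu' := hLP u hu
    have hm' := hBP m hm.1
    by_cases hvx : G.Adj v x
    · refine ((Joined.of_adj hux (hc₀ u hu x hx)).trans (hN v hv hvL x hx hvx).symm ?_
        (by decide)).exists_isProperPath
      have h1 := hne hu' hx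
      rintro y ⟨rfl | rfl, h | h⟩
      · exact absurd h huv'
      · exact h
      · rfl
      · rfl
    · obtain ⟨y, hy, hvy⟩ := hdom v hv
      have hxy : x ≠ y := by rintro rfl; exact hvx hvy
      refine hglue hx hy hxy ?_ (hpair hv) ?_ hj (hN v hv hvL y hy hvy)
      · rintro z ⟨rfl | rfl | rfl, h⟩
        · exact absurd h hu'
        · exact absurd h hm'
        · rfl
      · have h1 : m ≠ v := by rintro rfl; exact hvx hmx
        have h2 := hne hu' hy
        have h3 := hne hm' hy
        have h4 := hne hv hx
        rw [Set.disjoint_left]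
        rintro z (rfl | rfl | rfl) (h | h)
        · exact huv' h
        · exact h2 h
        · exact h1 h
        · exact h3 h
        · exact h4 h.symm
        · exact hxy h
  intro u v huv
  by_cases hadj : G.Adj u v
  · exact (Joined.of_adj hadj rfl).exists_isProperPath
  by_cases hu : u ∈ P
  · by_cases hv : v ∈ P
    · obtain ⟨a, -, b, -, h⟩ := hP u hu v hv huv
      exact h.exists_isProperPath
    · exact hrev (hPoff v hv u hu)
  by_cases hv : v ∈ P
  · exact hPoff u hu v hv
  by_cases huL : u ∈ L
  · by_cases hvL : v ∈ L
    · obtain ⟨m, hm, x, hx, hum, hux, hmx, hj⟩ := hL u huL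
      obtain ⟨n, hn, y, hy, hvn, hvy, hny, hj'⟩ := hL v hvL
      have hm' := hBP m hm.1
      have hn' := hBP n hn.1
      have h1 := hne hu hx
      have h2 := hne hv hx
      have h3 : m ≠ v := fun h => hm.2 (h ▸ hvL)
      have h4 : n ≠ u := fun h => hn.2 (h ▸ huL)
      by_cases hxy : x = y
      · subst hxy
        refine (hj.trans (Joined.of_adj hvy (hc₀ v hvL x hx)).symm ?_
          (by decide)).exists_isProperPath
        rintro z ⟨rfl | rfl | rfl, h | h⟩
        · exact absurd h huv
        · exact h
        · exact absurd h h3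
        · exact h
        · rfl
        · rfl
      · refine hglue hx hy hxy ?_ ?_ ?_ hj hj'
        · rintro z ⟨rfl | rfl | rfl, h⟩
          · exact absurd h hu
          · exact absurd h hm'
          · rfl
        · rintro z ⟨rfl | rfl | rfl, h⟩
          · exact absurd h hv
          · exact absurd h hn'
          · rfl
        · have h5 : m ≠ n := by
            rintro rfl
            exact hxy (((hB m).1 hm.1).2 x hx y hy hmx hny)
          rw [Set.disjoint_left]
          rintro z (rfl | rfl | rfl) (h | h | h)
          · exact huv h
          · exact h4 h.symm
          · exact hne hu hy h
          · exact h3 h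
          · exact h5 h
          · exact hne hm' hy h
          · exact h2 h.symm
          · exact hne hn' hx h.symm
          · exact hxy h
    · exact hLN u huL v hv hvL hadj huv
  by_cases hvL : v ∈ L
  · exact hrev (hLN v hvL u hu huL (fun h => hadj h.symm) huv.symm)
  by_cases hxy : ∃ x ∈ P, ∃ y ∈ P, x ≠ y ∧ G.Adj u x ∧ G.Adj v y
  · obtain ⟨x, hx, y, hy, hxy, hux, hvy⟩ := hxy
    refine hglue hx hy hxy (hpair hu) (hpair hv) ?_ (hN u hu huL x hx hux) (hN v hv hvL y hy hvy)
    rw [Set.disjoint_left]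
    rintro z (rfl | rfl) (h | h)
    · exact huv h
    · exact hne hu hy h
    · exact hne hv hx h.symm
    · exact hxy h
  -- Now `u` and `v` hang on the same single vertex `x` of `P`.
  push Not at hxy
  obtain ⟨x, hx, hux⟩ := hdom u hu
  obtain ⟨y, hy, hvy⟩ := hdom v hv
  obtain rfl : x = y := by
    by_contra h
    exact hxy x hx y hy h hux hvy
  have huB : u ∈ B := by
    rw [hB]
    refine ⟨hu, fun a ha b hb hua hub => ?_⟩
    rw [show a = x by by_contra h; exact hxy a ha x hx h hua hvy,
      show b = x by by_contra h; exact hxy b hb x hx h hub hvy]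
  obtain ⟨⟨w, hw, huw⟩, hw'⟩ := htri u huB
  have hwx := hw' x hx w hw hux huw
  have hwv : w ≠ v := by rintro rfl; exact hadj huw
  have hwx' := hne hw hx
  have hux' := hne hu hx
  have hvx' := hne hv hx
  by_cases hwL : w ∈ L
  · refine (((Joined.of_adj huw (hc₁ u hu w hw)).trans
      (Joined.of_adj hwx (hc₀ w hwL x hx)) ?_ (by decide)).trans
      (hN v hv hvL x hx hvy).symm ?_ (by decide)).exists_isProperPath
    · rintro z ⟨rfl | rfl, h | h⟩
      · exact h
      · exact absurd h hux'
      · rfl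
      · rfl
    · rintro z ⟨(rfl | rfl) | (rfl | rfl), h | h⟩
      · exact absurd h huv
      · exact h
      · exact absurd h hwv
      · exact h
      · exact absurd h hwv
      · exact h
      · rfl
      · rfl
  -- Otherwise `w` has a second neighbour `z` on `P`, and `u` detours through `w` and `z`.
  · have hwB : w ∉ B := fun h => hind u ⟨huB, huL⟩ w ⟨h, hwL⟩ huw
    obtain ⟨z, hz, hzx, hwz⟩ : ∃ z ∈ P, z ≠ x ∧ G.Adj w z := by
      by_contra! hcon
      refine hwB ((hB w).2 ⟨hw, fun a ha b hb hwa hwb => ?_⟩)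
      rw [show a = x by by_contra h; exact hcon a ha h hwa,
        show b = x by by_contra h; exact hcon b hb h hwb]
    refine hglue (S := {u, w} ∪ {w, z}) (T := {v, x}) hz hx hzx ?_ (hpair hv) ?_
      ((Joined.of_adj huw (hc₁ u hu w hw)).trans (hN w hw hwL z hz hwz) ?_ (by decide))
      (hN v hv hvL x hx hvy)
    · rintro t ⟨(rfl | rfl) | (rfl | rfl), h⟩
      · exact absurd h hu
      · exact absurd h hw
      · exact absurd h hw
      · rfl
    · rw [Set.disjoint_left]
      rintro t ((rfl | rfl) | (rfl | rfl)) (h | h)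
      · exact huv h
      · exact hux' h
      · exact hwv h
      · exact hwx' h
      · exact hwv h
      · exact hwx' h
      · exact hne hv hz h.symm
      · exact hzx h
    · rintro t ⟨rfl | rfl, h | h⟩
      · exact h
      · exact absurd h (hne hu hz)
      · rfl
      · rfl

theorem pc_le_three_of_isProperPathColoring {c : Sym2 V → ℕ} (hc : IsProperPathColoring G c)
    (h3 : ∀ e, c e < 3) : pc G ≤ 3 := by
  refine (iInf₂_le c hc).trans ?_
  have hsub : c '' G.edgeSet ⊆ ((Finset.range 3 : Finset ℕ) : Set ℕ) := by
    rintro _ ⟨e, -, rfl⟩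
    simpa using h3 e
  exact (Set.encard_le_encard hsub).trans (by rw [Set.encard_coe_eq_coe_finsetCard]; simp)

theorem exists_maximal_independent [Finite V] (G : SimpleGraph V) (B : Set V) :
    ∃ M ⊆ B, (∀ u ∈ M, ∀ v ∈ M, ¬ G.Adj u v) ∧ ∀ u ∈ B \ M, ∃ m ∈ M, G.Adj u m := by
  obtain ⟨M, hM, hmax⟩ := Set.Finite.exists_maximal
    (Set.toFinite {M : Set V | M ⊆ B ∧ ∀ u ∈ M, ∀ v ∈ M, ¬ G.Adj u v}) ⟨∅, by simp⟩
  refine ⟨M, hM.1, hM.2, fun u hu => ?_⟩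
  by_contra! hcon
  refine hu.2 (hmax (y := insert u M) ⟨Set.insert_subset hu.1 hM.1, ?_⟩
    (Set.subset_insert u M) (Set.mem_insert u M))
  rintro a (rfl | ha) b (rfl | hb)
  · exact G.irrefl
  · exact hcon b hb
  · exact fun h => hcon a ha h.symm
  · exact hM.2 a ha b hb

open Classical in
/-- If a path `p 0, …, p k` dominates `G`, and every vertex `u` off the path with a single
neighbour `x` on it has a neighbour off the path, all such neighbours being adjacent to `x`, then
three colours suffice. -/
theorem pc_le_three_of_path [Finite V] {p : ℕ → V} {k : ℕ} (hinj : Set.InjOn p (Set.Iic k))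
    (hadj : ∀ i < k, G.Adj (p i) (p (i + 1)))
    (hdom : ∀ u ∉ p '' Set.Iic k, ∃ x ∈ p '' Set.Iic k, G.Adj u x)
    (htri : ∀ u ∉ p '' Set.Iic k, (∀ x ∈ p '' Set.Iic k, ∀ y ∈ p '' Set.Iic k,
      G.Adj u x → G.Adj u y → x = y) → (∃ w ∉ p '' Set.Iic k, G.Adj u w) ∧
        ∀ x ∈ p '' Set.Iic k, ∀ w ∉ p '' Set.Iic k, G.Adj u x → G.Adj u w → G.Adj w x) :
    pc G ≤ 3 := by
  set P := p '' Set.Iic k with hPdef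
  have hmem : ∀ i ≤ k, p i ∈ P := fun i hi => ⟨i, hi, rfl⟩
  let B : Set V := {u | u ∉ P ∧ ∀ x ∈ P, ∀ y ∈ P, G.Adj u x → G.Adj u y → x = y}
  obtain ⟨M, hMB, hMind, hMmax⟩ := exists_maximal_independent G B
  have hLP : ∀ u ∈ B \ M, u ∉ P := fun u hu => hu.1.1
  -- The first clause lists the even edges of the path; its odd edges fall under the last clause.
  let c : Sym2 V → ℕ := fun e =>
    if (∃ i, 2 * i + 1 ≤ k ∧ e = s(p (2 * i), p (2 * i + 1))) ∨
      ((∃ x ∈ e, x ∈ P) ∧ ∃ x ∈ e, x ∈ B \ M) then 0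
    else if (∃ x ∈ e, x ∈ P) ∧ ∃ x ∈ e, x ∉ P then 2 else 1
  have hc3 : ∀ e, c e < 3 := by
    intro e
    simp only [c]
    split_ifs <;> decide
  -- An edge with an end off `P` is not an edge of the path.
  have hoff : ∀ u ∉ P, ∀ v, ¬ ∃ i, 2 * i + 1 ≤ k ∧ s(u, v) = s(p (2 * i), p (2 * i + 1)) := by
    rintro u hu v ⟨i, hi, h⟩
    have : u ∈ s(p (2 * i), p (2 * i + 1)) := h ▸ Sym2.mem_mk_left u v
    rcases Sym2.mem_iff.1 this with rfl | rfl
    · exact hu (hmem _ (by omega))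
    · exact hu (hmem _ hi)
  have hcpath : ∀ i < k, c s(p i, p (i + 1)) = i % 2 := by
    intro i hi
    have h1 := hmem i (by omega)
    have h2 := hmem (i + 1) (by omega)
    have hnoff : ¬ ∃ x ∈ s(p i, p (i + 1)), x ∉ P := by
      rintro ⟨x, hx, hxP⟩
      rcases Sym2.mem_iff.1 hx with rfl | rfl
      · exact hxP h1
      · exact hxP h2
    have hnL : ¬ ∃ x ∈ s(p i, p (i + 1)), x ∈ B \ M := fun ⟨x, hx, hxL⟩ =>
      hnoff ⟨x, hx, hLP x hxL⟩
    rcases Nat.even_or_odd' i with ⟨j, rfl | rfl⟩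
    · have : c s(p (2 * j), p (2 * j + 1)) = 0 := if_pos (Or.inl ⟨j, by omega, rfl⟩)
      omega
    · have : ¬ ∃ a, 2 * a + 1 ≤ k ∧
          s(p (2 * j + 1), p (2 * j + 1 + 1)) = s(p (2 * a), p (2 * a + 1)) := by
        rintro ⟨a, ha, h⟩
        have hp : ∀ {s t}, s ≤ k → t ≤ k → p s = p t → s = t := fun hs ht h => hinj hs ht h
        rcases Sym2.eq_iff.1 h with ⟨h, -⟩ | ⟨h, h'⟩
        · have := hp (by omega) (by omega) h
          omega
        · have := hp (by omega) (by omega) h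
          have := hp (by omega) (by omega) h'
          omega
      have : c s(p (2 * j + 1), p (2 * j + 1 + 1)) = 1 := by
        simp only [c]
        rw [if_neg (not_or.2 ⟨this, fun h => hnL h.2⟩), if_neg fun h => hnoff h.2]
      omega
  refine pc_le_three_of_isProperPathColoring (c := c) ?_ hc3
  refine isProperPathColoring_of_dominating (P := P) (B := B) (L := B \ M)
    (fun x hx y hy => joined_of_alternating_of_ne hinj hadj hcpath hx hy) hdom (fun u => Iff.rfl)
    (fun u hu => htri u hu.1 hu.2) Set.sdiff_subset ?_ ?_ ?_ ?_ ?_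
  · rw [Set.sdiff_sdiff_cancel_left hMB]
    exact hMind
  · rw [Set.sdiff_sdiff_cancel_left hMB]
    exact hMmax
  · intro u hu v hv
    have hn : ¬ ∃ x ∈ s(u, v), x ∈ P := by
      rintro ⟨x, hx, hxP⟩
      rcases Sym2.mem_iff.1 hx with rfl | rfl
      · exact hu hxP
      · exact hv hxP
    have := hoff u hu v
    simp only [c]
    rw [if_neg (not_or.2 ⟨this, fun h => hn h.1⟩), if_neg fun h => hn h.1]
  · intro u hu x hx
    exact if_pos (Or.inr ⟨⟨x, Sym2.mem_mk_right _ _, hx⟩, u, Sym2.mem_mk_left _ _, hu⟩)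
  · intro u hu hu' x hx
    have hn : ¬ ∃ y ∈ s(u, x), y ∈ B \ M := by
      rintro ⟨y, hy, hyL⟩
      rcases Sym2.mem_iff.1 hy with rfl | rfl
      · exact hu hyL
      · exact hLP _ hyL hx
    have := hoff u hu' x
    simp only [c]
    rw [if_neg (not_or.2 ⟨this, fun h => hn h.2⟩),
      if_pos ⟨⟨x, Sym2.mem_mk_right _ _, hx⟩, u, Sym2.mem_mk_left _ _, hu'⟩]

/-- A path whose sets cover all the sets of an intersection graph dominates it, and a vertex `u`
off the path with a single neighbour `x` on it has its set inside that of `x`: every other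
neighbour of `u` is then a neighbour of `x`. -/
theorem pc_le_three_of_covering_path {α : Type*} [Fintype V] [DecidableRel G.Adj] {S : V → Set α}
    (hS : ∀ v, (S v).Nonempty) (hG : ∀ u v, G.Adj u v ↔ u ≠ v ∧ (S u ∩ S v).Nonempty)
    (hdeg : 2 ≤ G.minDegree) {p : ℕ → V} {k : ℕ} (hinj : Set.InjOn p (Set.Iic k))
    (hadj : ∀ i < k, G.Adj (p i) (p (i + 1))) (hcov : ∀ v, ∀ t ∈ S v, ∃ i ≤ k, t ∈ S (p i)) :
    pc G ≤ 3 := by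
  refine pc_le_three_of_path hinj hadj ?_ ?_
  · intro u hu
    obtain ⟨t, ht⟩ := hS u
    obtain ⟨i, hi, hti⟩ := hcov u t ht
    exact ⟨p i, ⟨i, hi, rfl⟩, (hG _ _).2 ⟨fun h => hu ⟨i, hi, h.symm⟩, t, ht, hti⟩⟩
  · intro u hu huniq
    refine ⟨?_, ?_⟩
    · have h2 := hdeg.trans (G.minDegree_le_degree u)
      rw [← SimpleGraph.card_neighborFinset_eq_degree] at h2
      obtain ⟨a, ha, b, hb, hab⟩ := Finset.one_lt_card.1 (show 1 < _ from h2)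
      rw [SimpleGraph.mem_neighborFinset] at ha hb
      by_cases haP : a ∈ p '' Set.Iic k
      · exact ⟨b, fun hbP => hab (huniq a haP b hbP ha hb), hb⟩
      · exact ⟨a, haP, ha⟩
    · intro x hx w hw hux huw
      obtain ⟨t, htu, htw⟩ := ((hG u w).1 huw).2
      obtain ⟨i, hi, hti⟩ := hcov u t htu
      have hui : G.Adj u (p i) := (hG _ _).2 ⟨fun h => hu ⟨i, hi, h.symm⟩, t, htu, hti⟩
      obtain rfl := huniq _ ⟨i, hi, rfl⟩ x hx hui hux
      exact (hG _ _).2 ⟨fun h => hw ⟨i, hi, h.symm⟩, t, htw, hti⟩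

/-! ### Covering paths in interval graphs and circular arc graphs -/

/-- The intersection graph of a family of sets. -/
def interGraph {α : Type*} (S : V → Set α) : SimpleGraph V where
  Adj u v := u ≠ v ∧ (S u ∩ S v).Nonempty
  symm := ⟨fun u v h => ⟨h.1.symm, by rw [Set.inter_comm]; exact h.2⟩⟩
  loopless := ⟨fun u h => h.1 rfl⟩

/-- The intervals met along a walk in an intersection graph have an interval as their union. -/
theorem ordConnected_iUnion_support {W : Type*} {H : SimpleGraph W} {J : W → Set ℝ}
    (hJ : ∀ x, (J x).OrdConnected) (hH : ∀ x y, H.Adj x y → (J x ∩ J y).Nonempty) {x y : W}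
    (w : H.Walk x y) : {t | ∃ z ∈ w.support, t ∈ J z}.OrdConnected := by
  induction w with
  | nil => simpa using hJ _
  | @cons a b d h q ih =>
    obtain ⟨t, hta, htb⟩ := hH _ _ h
    have heq : {t | ∃ z ∈ (SimpleGraph.Walk.cons h q).support, t ∈ J z} =
        J a ∪ {t | ∃ z ∈ q.support, t ∈ J z} := by
      ext s
      simp
    rw [heq, ← isPreconnected_iff_ordConnected]
    exact IsPreconnected.union t hta ⟨b, q.start_mem_support, htb⟩
      (hJ a).isPreconnected ih.isPreconnected

/-- A path from an interval reaching furthest to the left to one reaching furthest to the right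
covers the union of all intervals. -/
theorem pc_le_three_of_isIntervalGraph [Fintype V] [DecidableRel G.Adj] (hconn : G.Connected)
    (hG : IsIntervalGraph G) (hdeg : 2 ≤ G.minDegree) : pc G ≤ 3 := by
  obtain ⟨S, hS, hG⟩ := hG
  have := hconn.nonempty
  -- An interval reaching furthest to the left, and one reaching furthest to the right.
  obtain ⟨x, hx⟩ : ∃ x, ∀ v, ∀ t ∈ S v, ∃ s ∈ S x, s ≤ t := by
    obtain ⟨x, hx⟩ := Finite.exists_min fun v => upperClosure (S v)
    exact ⟨x, fun v t ht => mem_upperClosure.1 (hx v (subset_upperClosure ht))⟩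
  obtain ⟨y, hy⟩ : ∃ y, ∀ v, ∀ t ∈ S v, ∃ s ∈ S y, t ≤ s := by
    obtain ⟨y, hy⟩ := Finite.exists_max fun v => lowerClosure (S v)
    exact ⟨y, fun v t ht => mem_lowerClosure.1 (hy v (subset_lowerClosure ht))⟩
  obtain ⟨w, hw⟩ := hconn.exists_isPath x y
  refine pc_le_three_of_covering_path (fun v => (hS v).1) hG hdeg (p := w.getVert) (k := w.length)
    hw.getVert_injOn (fun i hi => w.adj_getVert_succ hi) fun v t ht => ?_
  obtain ⟨s, hs, hst⟩ := hx v t ht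
  obtain ⟨r, hr, htr⟩ := hy v t ht
  obtain ⟨z, hz, htz⟩ := (ordConnected_iUnion_support (fun v => (hS v).2)
    (fun u v h => ((hG u v).1 h).2) w).out ⟨x, w.start_mem_support, hs⟩
      ⟨y, w.end_mem_support, hr⟩ ⟨hst, htr⟩
  obtain ⟨i, rfl, hi⟩ := SimpleGraph.Walk.mem_support_iff_exists_getVert.1 hz
  exact ⟨i, hi, htz⟩

/-- The translate by the integer `x.2` of the interval lifting the arc of the vertex `x.1`. -/
def lift (I : V → Set ℝ) (x : V × ℤ) : Set ℝ := {t | t - x.2 ∈ I x.1}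

theorem coe_eq_coe_iff {s t : ℝ} : (s : UnitAddCircle) = t ↔ ∃ n : ℤ, s = t + n := by
  rw [← sub_eq_zero, ← AddCircle.coe_sub, AddCircle.coe_eq_zero_iff]
  simp only [zsmul_eq_mul, mul_one]
  exact exists_congr fun n => ⟨fun h => by linarith, fun h => by linarith⟩

theorem image_inter_image_nonempty_iff {I J : Set ℝ} :
    ((fun x : ℝ => (x : UnitAddCircle)) '' I ∩ (fun x : ℝ => (x : UnitAddCircle)) '' J).Nonempty ↔
      ∃ s ∈ I, ∃ t ∈ J, ∃ n : ℤ, s = t + n := by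
  constructor
  · rintro ⟨_, ⟨s, hs, rfl⟩, t, ht, h⟩
    exact ⟨s, hs, t, ht, coe_eq_coe_iff.1 h.symm⟩
  · rintro ⟨s, hs, t, ht, h⟩
    exact ⟨s, ⟨s, hs, rfl⟩, t, ht, (coe_eq_coe_iff.2 h).symm⟩

/-- In the graph of all lifts to the line, either two lifts of some vertex are connected, and a
shortest walk of this kind yields a path covering the circle, or a connected component contains
one lift of each vertex, and represents `G` as an interval graph. -/
theorem pc_le_three_of_isCircularArcGraph [Fintype V] [DecidableRel G.Adj] (hconn : G.Connected)
    (hG : IsCircularArcGraph G) (hdeg : 2 ≤ G.minDegree) : pc G ≤ 3 := by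
  obtain ⟨S, hS, hG⟩ := hG
  choose I hI hSI using hS
  have hG' : ∀ u v, G.Adj u v ↔ u ≠ v ∧ ∃ s ∈ I u, ∃ t ∈ I v, ∃ n : ℤ, s = t + n := fun u v => by
    rw [hG, hSI u, hSI v, image_inter_image_nonempty_iff]
  have hord : ∀ x, (lift I x).OrdConnected := fun x =>
    (hI x.1).2.preimage_mono fun a b h => by simpa using h
  have hmeet : ∀ x y, (lift I x ∩ lift I y).Nonempty →
      ∃ s ∈ I x.1, ∃ t ∈ I y.1, ∃ n : ℤ, s = t + n := by
    rintro x y ⟨t, hx, hy⟩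
    exact ⟨_, hx, _, hy, y.2 - x.2, by push_cast; ring⟩
  set H := interGraph (lift I)
  by_cases hwrap : ∃ v, ∃ m n : ℤ, m ≠ n ∧ H.Reachable (v, m) (v, n)
  · -- A shortest walk between two lifts of one vertex covers the circle, and the vertices on it
    -- are distinct apart from its two ends.
    have hex : ∃ d, ∃ v, ∃ m n : ℤ, m ≠ n ∧ H.Reachable (v, m) (v, n) ∧
        H.dist (v, m) (v, n) = d := by
      obtain ⟨v, m, n, hmn, h⟩ := hwrap
      exact ⟨_, v, m, n, hmn, h, rfl⟩
    classical
    obtain ⟨v, m, n, hmn, hr, hd⟩ := Nat.find_spec hex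
    have hmin : ∀ v' (m' n' : ℤ), m' ≠ n' → ∀ q : H.Walk (v', m') (v', n'),
        Nat.find hex ≤ q.length := fun v' m' n' h q =>
      (Nat.find_min' hex ⟨v', m', n', h, ⟨q⟩, rfl⟩).trans (SimpleGraph.dist_le q)
    set d := Nat.find hex
    obtain ⟨w, hw⟩ := hr.exists_walk_length_eq_dist
    have hwp := w.isPath_of_length_eq_dist hw
    rw [hd] at hw
    have hd0 : d ≠ 0 := by
      intro h0
      have := SimpleGraph.Walk.eq_of_length_eq_zero (hw.trans h0)
      exact hmn (congrArg Prod.snd this)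
    have hinj : Set.InjOn (fun i => (w.getVert i).1) (Set.Iic (d - 1)) := by
      have key : ∀ i j, i < j → j ≤ d - 1 → (w.getVert i).1 ≠ (w.getVert j).1 := by
        intro i j hij hj h
        -- Equal first coordinates would give a shorter walk between two lifts of one vertex.
        have hne : (w.getVert i).2 ≠ (w.getVert j).2 := by
          intro h'
          have := hwp.getVert_injOn (x₁ := i) (x₂ := j) (show i ≤ w.length by omega)
            (show j ≤ w.length by omega) (Prod.ext h h')
          omega
        let q : H.Walk (w.getVert i) (w.getVert j) :=
          ((w.drop i).take (j - i)).copy rfl (by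
            rw [SimpleGraph.Walk.drop_getVert]; congr 1; omega)
        have hq : q.length ≤ j - i := by
          simp only [q, SimpleGraph.Walk.length_copy, SimpleGraph.Walk.take_length]
          exact min_le_left _ _
        have := hmin _ _ _ hne (q.copy rfl (Prod.ext h.symm rfl))
        rw [SimpleGraph.Walk.length_copy] at this
        omega
      intro i hi j hj h
      rcases lt_trichotomy i j with hij | hij | hij
      · exact absurd h (key i j hij hj)
      · exact hij
      · exact absurd h.symm (key j i hij hi)
    refine pc_le_three_of_covering_path (S := S) (fun v => ?_) hG hdeg hinj ?_ ?_
    · rw [hSI]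
      exact (hI v).1.image _
    · intro i hi
      refine (hG' _ _).2 ⟨fun h => ?_, hmeet _ _ (w.adj_getVert_succ (by omega)).2⟩
      have := hinj (Set.mem_Iic.2 (by omega)) (Set.mem_Iic.2 (by omega)) h
      omega
    · intro u t _
      obtain ⟨t, rfl⟩ := QuotientAddGroup.mk_surjective t
      obtain ⟨s, hs⟩ := (hI v).1
      have hU := ordConnected_iUnion_support hord (fun x y (h : H.Adj x y) => h.2) w
      have hm : s + m ∈ {t | ∃ z ∈ w.support, t ∈ lift I z} :=
        ⟨_, w.start_mem_support, by simpa [lift] using hs⟩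
      have hn : s + n ∈ {t | ∃ z ∈ w.support, t ∈ lift I z} :=
        ⟨_, w.end_mem_support, by simpa [lift] using hs⟩
      -- The union of the lifts along the walk contains a whole period.
      obtain ⟨e, he⟩ : ∃ e : ℤ, t + e ∈ Set.uIcc (s + m) (s + n) := by
        refine ⟨⌈min (s + m) (s + n) - t⌉, ?_, ?_⟩
        · have := Int.le_ceil (min (s + m) (s + n) - t)
          linarith
        · have h1 := Int.ceil_lt_add_one (min (s + m) (s + n) - t)
          rcases lt_or_gt_of_ne hmn with h | h
          · have h2 : (m : ℝ) + 1 ≤ n := by exact_mod_cast h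
            rw [min_eq_left (by linarith)] at h1 ⊢
            rw [max_eq_right (by linarith)]
            linarith
          · have h2 : (n : ℝ) + 1 ≤ m := by exact_mod_cast h
            rw [min_eq_right (by linarith)] at h1 ⊢
            rw [max_eq_left (by linarith)]
            linarith
      obtain ⟨z, hz, htz⟩ := hU.uIcc_subset hm hn he
      obtain ⟨i, hi, hiz⟩ : ∃ i ≤ d - 1, (w.getVert i).1 = z.1 := by
        obtain ⟨i, rfl, hi⟩ := SimpleGraph.Walk.mem_support_iff_exists_getVert.1 hz
        rcases Nat.lt_or_ge i d with h | h
        · exact ⟨i, by omega, rfl⟩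
        · refine ⟨0, Nat.zero_le _, ?_⟩
          rw [w.getVert_of_length_le (hw.trans_le h), w.getVert_zero]
      refine ⟨i, hi, ?_⟩
      simp only [hiz, hSI]
      exact ⟨_, htz, coe_eq_coe_iff.2 ⟨e - z.2, by push_cast; ring⟩⟩
  · push Not at hwrap
    -- Following `G` from one lift of a vertex selects a single lift of every vertex.
    obtain ⟨v₀⟩ := hconn.nonempty
    have hadj : ∀ u v, u ≠ v → ∀ s ∈ I u, ∀ t ∈ I v, ∀ n : ℤ, s = t + n → ∀ m : ℤ,
        H.Adj (u, m) (v, n + m) := by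
      refine fun u v huv s hs t ht n hst m => ⟨fun h => huv (congrArg Prod.fst h), s + m, ?_, ?_⟩
      · simpa [lift] using hs
      · have : s + m - ((n + m : ℤ) : ℝ) = t := by push_cast; linarith
        simpa only [lift, Set.mem_ofPred_eq, this] using ht
    have hwalk : ∀ u v, G.Walk u v → ∀ m, ∃ n, H.Reachable (u, m) (v, n) := by
      intro u v w
      induction w with
      | nil => exact fun m => ⟨m, SimpleGraph.Reachable.refl _⟩
      | cons h q ih =>
        intro m
        obtain ⟨hne, s, hs, t, ht, n, hst⟩ := (hG' _ _).1 h
        obtain ⟨l, hl⟩ := ih (n + m)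
        exact ⟨l, (hadj _ _ hne s hs t ht n hst m).reachable.trans hl⟩
    have hsel : ∀ v, ∃ n, H.Reachable (v₀, 0) (v, n) := fun v =>
      (hconn.preconnected v₀ v).elim fun w => hwalk v₀ v w 0
    choose n hn using hsel
    refine pc_le_three_of_isIntervalGraph hconn ⟨fun v => lift I (v, n v), fun v => ⟨?_, hord _⟩,
      fun u v => ⟨fun h => ⟨h.ne, ?_⟩, fun h => (hG' u v).2 ⟨h.1, hmeet _ _ h.2⟩⟩⟩ hdeg
    · obtain ⟨s, hs⟩ := (hI v).1
      exact ⟨s + n v, by simpa [lift] using hs⟩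
    · obtain ⟨hne, s, hs, t, ht, l, hst⟩ := (hG' u v).1 h
      have hl := hadj u v hne s hs t ht l hst (n u)
      have : n v = l + n u := by
        by_contra hcon
        exact hwrap v _ _ hcon ((hn v).symm.trans ((hn u).trans hl.reachable))
      rw [← this] at hl
      exact hl.2

/-! ### Graphs that need three colours -/

/-- A pendant triangle at `p`: `a` and `b` form a triangle with `p` and have no neighbours outside
this triangle. -/
structure IsPendantTriangle (G : SimpleGraph V) (p a b : V) : Prop where
  adj : G.Adj a b
  adj_left : G.Adj a p
  adj_right : G.Adj b p
  left : ∀ x, G.Adj a x → x = b ∨ x = p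
  right : ∀ x, G.Adj b x → x = a ∨ x = p

theorem IsPendantTriangle.symm {p a b : V} (h : IsPendantTriangle G p a b) :
    IsPendantTriangle G p b a :=
  ⟨h.adj.symm, h.adj_right, h.adj_left, h.right, h.left⟩

/-- If `ab` or `ap` is coloured like `bp`, then the detour from `a` to `p` through `b` is either not
proper or ends with the colour of `ap`.  So a proper path leaving the triangle from `a` continues
from `p` with another colour than that of `ap`. -/
theorem IsPendantTriangle.exists_walk {c : Sym2 V → ℕ} {p a b y : V}
    (h : IsPendantTriangle G p a b) (hc : c s(a, b) = c s(b, p) ∨ c s(a, p) = c s(b, p))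
    (hya : y ≠ a) (hyb : y ≠ b) (w : G.Walk a y) (hw : IsProperPath c w) :
    ∃ q : G.Walk p y, IsProperPath c q ∧ ∀ e ∈ q.edges.head?, c e ≠ c s(a, p) := by
  cases w with
  | nil => exact absurd rfl hya
  | @cons _ x _ hx q =>
    obtain ⟨hw, hw'⟩ := hw
    rw [SimpleGraph.Walk.cons_isPath_iff] at hw
    rw [SimpleGraph.Walk.edges_cons, List.isChain_cons] at hw'
    rcases h.left _ hx with rfl | rfl
    · cases q with
      | nil => exact absurd rfl hyb
      | @cons _ x' _ hx' q =>
        rcases h.right _ hx' with rfl | rfl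
        · exact absurd (by simp) hw.2
        · have hc := hc.resolve_left (hw'.1 _ (by simp))
          have hw'' := hw'.2
          rw [SimpleGraph.Walk.edges_cons, List.isChain_cons] at hw''
          exact ⟨q, ⟨hw.1.of_cons, hw''.2⟩, fun e he => hc ▸ (hw''.1 e he).symm⟩
    · exact ⟨q, ⟨hw.1, hw'.2⟩, fun e he => (hw'.1 e he).symm⟩

theorem IsPendantTriangle.getLast_edges {c : Sym2 V → ℕ} {p a b : V}
    (h : IsPendantTriangle G p a b) (hc : c s(a, b) = c s(b, p) ∨ c s(a, p) = c s(b, p))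
    (w : G.Walk a p) (hw : IsProperPath c w) : ∃ e ∈ w.edges.getLast?, c e = c s(a, p) := by
  cases w with
  | nil => exact absurd h.adj_left G.irrefl
  | @cons _ x _ hx q =>
    obtain ⟨hw, hw'⟩ := hw
    rw [SimpleGraph.Walk.cons_isPath_iff] at hw
    rw [SimpleGraph.Walk.edges_cons, List.isChain_cons] at hw'
    rcases h.left _ hx with rfl | rfl
    · cases q with
      | nil => exact ⟨_, by simp, rfl⟩
      | @cons _ x' _ hx' q =>
        rcases h.right _ hx' with rfl | rfl
        · exact absurd (by simp) hw.2
        · have hc := hc.resolve_left (hw'.1 _ (by simp))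
          obtain rfl :=
            SimpleGraph.Walk.eq_nil_iff_nil.2 (SimpleGraph.Walk.isPath_iff_nil.1 hw.1.of_cons)
          exact ⟨_, by simp, hc.symm⟩
    · obtain rfl := SimpleGraph.Walk.eq_nil_iff_nil.2 (SimpleGraph.Walk.isPath_iff_nil.1 hw.1)
      exact ⟨_, by simp, rfl⟩

theorem exists_ne_map_eq_of_encard_lt {s : Set ℕ} (hs : s.encard < 3) (f : Fin 3 → ℕ)
    (hf : ∀ i, f i ∈ s) : ∃ i j, i ≠ j ∧ f i = f j := by
  by_contra! hcon
  have hinj : Function.Injective f := fun i j h => by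
    by_contra hij
    exact hcon i j hij h
  have h1 := hinj.encard_range.trans (Set.encard_le_encard (Set.range_subset_iff.2 hf))
  simp only [ENat.card_eq_coe_fintype_card, Fintype.card_fin] at h1
  exact absurd (h1.trans_lt hs) (by decide)

/-- With at most two colours, two edges of a pendant triangle have the same colour, so that one of
its two orientations satisfies the hypothesis of `IsPendantTriangle.exists_walk`. -/
theorem IsPendantTriangle.exists_oriented {c : Sym2 V → ℕ} {p a b : V}
    (h : IsPendantTriangle G p a b) (hc : (c '' G.edgeSet).encard < 3) :
    ∃ a' b', (a' = a ∧ b' = b ∨ a' = b ∧ b' = a) ∧ IsPendantTriangle G p a' b' ∧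
      (c s(a', b') = c s(b', p) ∨ c s(a', p) = c s(b', p)) := by
  obtain ⟨i, j, hij, heq⟩ := exists_ne_map_eq_of_encard_lt hc ![c s(a, p), c s(b, p), c s(a, b)] (by
    intro i
    fin_cases i
    · exact ⟨_, h.adj_left, rfl⟩
    · exact ⟨_, h.adj_right, rfl⟩
    · exact ⟨_, h.adj, rfl⟩)
  have key : c s(a, p) = c s(b, p) ∨ c s(a, b) = c s(b, p) ∨ c s(a, b) = c s(a, p) := by
    fin_cases i <;> fin_cases j <;> simp_all
  rcases key with hk | hk | hk
  · exact ⟨a, b, Or.inl ⟨rfl, rfl⟩, h, Or.inr hk⟩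
  · exact ⟨a, b, Or.inl ⟨rfl, rfl⟩, h, Or.inl hk⟩
  · exact ⟨b, a, Or.inr ⟨rfl, rfl⟩, h.symm, Or.inl (by rw [Sym2.eq_swap, hk])⟩

/-- With two colours, each pendant triangle has a vertex all of whose proper paths to `p` end with
one and the same colour, and for two of three triangles these colours agree. -/
theorem three_le_pc {p : V} {a b : Fin 3 → V} (h : ∀ j, IsPendantTriangle G p (a j) (b j))
    (hdisj : ∀ i j, i ≠ j → a i ≠ a j ∧ a i ≠ b j ∧ b i ≠ b j) : 3 ≤ pc G := by
  refine le_iInf₂ fun c hc => ?_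
  by_contra! hlt
  choose a' b' hab h' hc' using fun j => (h j).exists_oriented hlt
  obtain ⟨i, j, hij, heq⟩ := exists_ne_map_eq_of_encard_lt hlt (fun j => c s(a' j, p))
    fun j => ⟨_, (h' j).adj_left, rfl⟩
  have h1 := hdisj i j hij
  have h2 := hdisj j i hij.symm
  have hne : a' j ≠ a' i ∧ a' j ≠ b' i := by
    rcases hab i with ⟨e1, e2⟩ | ⟨e1, e2⟩ <;> rcases hab j with ⟨e3, -⟩ | ⟨e3, -⟩ <;>
      rw [e1, e2, e3] <;> tauto
  obtain ⟨w, hw⟩ := hc (a' i) (a' j) hne.1.symm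
  obtain ⟨q, hq, hhead⟩ := (h' i).exists_walk (hc' i) hne.1 hne.2 w hw
  obtain ⟨e, he, hlast⟩ := (h' j).getLast_edges (hc' j) q.reverse hq.reverse
  rw [SimpleGraph.Walk.edges_reverse, List.getLast?_reverse] at he
  exact hhead e he (hlast.trans heq.symm)

/-! ### Excluding interval representations -/

/-- When the interval `A` lies to the left of `D`, both `B` and `E` contain the gap between them. -/
theorem inter_nonempty_of_square {A B D E : Set ℝ} (hA : A.OrdConnected) (hB : B.OrdConnected)
    (hD : D.OrdConnected) (hE : E.OrdConnected) (hAD : ∀ z ∈ A, z ∉ D) {r s t q : ℝ}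
    (hr : r ∈ A ∩ B) (hs : s ∈ B ∩ D) (ht : t ∈ D ∩ E) (hq : q ∈ E ∩ A) (hrs : r < s) :
    (B ∩ E).Nonempty := by
  have hlt : ∀ x ∈ A, ∀ y ∈ D, x < y := by
    intro x hx y hy
    have hry : r < y := by
      by_contra! h
      exact hAD r hr.1 (hD.out hy hs.2 ⟨h, hrs.le⟩)
    by_contra! h
    exact hAD y (hA.out hr.1 hx ⟨hry.le, h⟩) hy
  have hz : max r q ∈ A := by
    rcases max_choice r q with h | h <;> rw [h]
    exacts [hr.1, hq.2]
  exact ⟨max r q, hB.out hr.2 hs.1 ⟨le_max_left _ _, (hlt _ hz s hs.2).le⟩,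
    hE.out hq.1 ht.2 ⟨le_max_right _ _, (hlt _ hz t ht.1).le⟩⟩

/-- An interval graph has no induced four-cycle. -/
theorem not_isIntervalGraph_of_square {a b d e : V} (hab : G.Adj a b) (hbd : G.Adj b d)
    (hde : G.Adj d e) (hea : G.Adj e a) (had : ¬ G.Adj a d) (hbe : ¬ G.Adj b e) (had' : a ≠ d)
    (hbe' : b ≠ e) : ¬ IsIntervalGraph G := by
  rintro ⟨S, hS, hG⟩
  have hord := fun v => (hS v).2
  obtain ⟨-, r, hr⟩ := (hG _ _).1 hab
  obtain ⟨-, s, hs⟩ := (hG _ _).1 hbd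
  obtain ⟨-, t, ht⟩ := (hG _ _).1 hde
  obtain ⟨-, q, hq⟩ := (hG _ _).1 hea
  have hdisj : ∀ z ∈ S a, z ∉ S d := fun z h h' => had ((hG _ _).2 ⟨had', z, h, h'⟩)
  refine hbe ((hG _ _).2 ⟨hbe', ?_⟩)
  rcases lt_trichotomy r s with h | h | h
  · exact inter_nonempty_of_square (hord a) (hord b) (hord d) (hord e) hdisj hr hs ht hq h
  · exact absurd (h ▸ hs.2) (hdisj r hr.1)
  · exact inter_nonempty_of_square (hord d) (hord b) (hord a) (hord e)
      (fun z h h' => hdisj z h' h) hs.symm hr.symm hq.symm ht.symm h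

/-! ### Examples -/

theorem two_le_minDegree [Fintype V] [Nonempty V] [DecidableRel G.Adj]
    (h : ∀ u, ∃ x y, x ≠ y ∧ G.Adj u x ∧ G.Adj u y) : 2 ≤ G.minDegree := by
  refine G.le_minDegree_of_forall_le_degree 2 fun u => ?_
  obtain ⟨x, y, hxy, hx, hy⟩ := h u
  rw [← SimpleGraph.card_neighborFinset_eq_degree]
  exact Finset.one_lt_card.2 ⟨x, by simpa using hx, y, by simpa using hy, hxy⟩

/-- The point that is the `i`-th interval of the interval example, for `i ≠ 0`. -/
def fanPoint (i : ℕ) : ℕ := min ((i + 1) / 2) 4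

/-- The intervals of the interval example: the whole line, two copies of each of the points `1`,
`2`, `3`, and all the others equal to the point `4`. -/
def fanInterval (i : ℕ) : Set ℝ := if i = 0 then Set.univ else {(fanPoint i : ℝ)}

theorem fanInterval_mem (i : ℕ) : fanInterval i ∈ realIntervals := by
  unfold fanInterval
  split_ifs
  · exact ⟨Set.univ_nonempty, Set.ordConnected_univ⟩
  · exact ⟨Set.singleton_nonempty _, Set.ordConnected_singleton⟩

theorem fanInterval_inter_nonempty_iff {i j : ℕ} :
    (fanInterval i ∩ fanInterval j).Nonempty ↔ i = 0 ∨ j = 0 ∨ fanPoint i = fanPoint j := by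
  unfold fanInterval
  split_ifs with hi hj hj
  · simp [hi]
  · simp [hi]
  · simp [hj]
  · simp [hi, hj, eq_comm]

/-- Left end, in ninths of the circle, of the `i`-th arc of the circular arc example. -/
def arcLeft (i : ℕ) : ℕ := if i = 0 then 0 else if i < 4 then i + 5 else min (i / 2 - 1) 4

/-- Right end, in ninths of the circle, of the `i`-th arc of the circular arc example. -/
def arcRight (i : ℕ) : ℕ := if i < 4 then i + 6 else min (i / 2 - 1) 4

/-- Lifts to the line of the arcs of the circular arc example: four arcs placed around the circle as
a four-cycle, the first of which contains two copies of each of three points, and all the other arcs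
equal to a fourth point of the first arc. -/
def squareInterval (i : ℕ) : Set ℝ := Set.Icc ((arcLeft i : ℝ) / 9) ((arcRight i : ℝ) / 9)

theorem arcLeft_le_arcRight (i : ℕ) : arcLeft i ≤ arcRight i := by
  unfold arcLeft arcRight
  split_ifs <;> omega

theorem arcRight_le (i : ℕ) : arcRight i ≤ 9 := by
  unfold arcRight
  split_ifs <;> omega

theorem squareInterval_mem (i : ℕ) : squareInterval i ∈ realIntervals := by
  refine ⟨Set.nonempty_Icc.2 ?_, Set.ordConnected_Icc⟩
  have : (arcLeft i : ℝ) ≤ arcRight i := by exact_mod_cast arcLeft_le_arcRight i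
  linarith

/-- Two arcs with lifts in `[0, 1]` meet when the lifts meet or when one lift contains `0` and the
other `1`, which are the same point of the circle. -/
theorem image_Icc_inter_image_Icc_nonempty_iff {a b c d : ℕ} (hab : a ≤ b) (hb : b ≤ 9)
    (hcd : c ≤ d) (hd : d ≤ 9) :
    ((fun x : ℝ => (x : UnitAddCircle)) '' Set.Icc ((a : ℝ) / 9) ((b : ℝ) / 9) ∩
      (fun x : ℝ => (x : UnitAddCircle)) '' Set.Icc ((c : ℝ) / 9) ((d : ℝ) / 9)).Nonempty ↔
      a ≤ d ∧ c ≤ b ∨ a = 0 ∧ d = 9 ∨ c = 0 ∧ b = 9 := by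
  have hab' : (a : ℝ) ≤ b := by exact_mod_cast hab
  have hcd' : (c : ℝ) ≤ d := by exact_mod_cast hcd
  have hb' : (b : ℝ) ≤ 9 := by exact_mod_cast hb
  have hd' : (d : ℝ) ≤ 9 := by exact_mod_cast hd
  have ha0 : (0 : ℝ) ≤ a := Nat.cast_nonneg a
  have hc0 : (0 : ℝ) ≤ c := Nat.cast_nonneg c
  rw [image_inter_image_nonempty_iff]
  constructor
  · rintro ⟨s, ⟨hs1, hs2⟩, t, ⟨ht1, ht2⟩, n, h⟩
    have hn1 : n ≤ 1 := by
      have : (n : ℝ) ≤ 1 := by linarith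
      exact_mod_cast this
    have hn2 : -1 ≤ n := by
      have : (-1 : ℝ) ≤ n := by linarith
      exact_mod_cast this
    obtain rfl | rfl | rfl : n = -1 ∨ n = 0 ∨ n = 1 := by omega
    · refine Or.inr (Or.inl ⟨?_, ?_⟩)
      · have : (a : ℝ) ≤ 0 := by push_cast at h; linarith
        exact Nat.le_zero.1 (by exact_mod_cast this)
      · have : (9 : ℝ) ≤ d := by push_cast at h; linarith
        exact le_antisymm hd (by exact_mod_cast this)
    · refine Or.inl ⟨?_, ?_⟩
      · have : (a : ℝ) ≤ d := by push_cast at h; linarith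
        exact_mod_cast this
      · have : (c : ℝ) ≤ b := by push_cast at h; linarith
        exact_mod_cast this
    · refine Or.inr (Or.inr ⟨?_, ?_⟩)
      · have : (c : ℝ) ≤ 0 := by push_cast at h; linarith
        exact Nat.le_zero.1 (by exact_mod_cast this)
      · have : (9 : ℝ) ≤ b := by push_cast at h; linarith
        exact le_antisymm hb (by exact_mod_cast this)
  · rintro (⟨h1, h2⟩ | ⟨rfl, rfl⟩ | ⟨rfl, rfl⟩)
    · have h1' : (a : ℝ) ≤ d := by exact_mod_cast h1
      have h2' : (c : ℝ) ≤ b := by exact_mod_cast h2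
      rcases le_total (a : ℝ) c with h | h
      · exact ⟨c / 9, ⟨by linarith, by linarith⟩, c / 9, ⟨le_rfl, by linarith⟩, 0, by simp⟩
      · exact ⟨a / 9, ⟨le_rfl, by linarith⟩, a / 9, ⟨by linarith, by linarith⟩, 0, by simp⟩
    · exact ⟨0, ⟨by simp, by linarith⟩, 1, ⟨by push_cast at hcd'; linarith, by norm_num⟩, -1, by simp⟩
    · exact ⟨1, ⟨by push_cast at hab'; linarith, by norm_num⟩, 0, ⟨by simp, by linarith⟩, 1, by simp⟩

theorem squareArc_inter_nonempty_iff {i j : ℕ} :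
    ((fun x : ℝ => (x : UnitAddCircle)) '' squareInterval i ∩
      (fun x : ℝ => (x : UnitAddCircle)) '' squareInterval j).Nonempty ↔
      arcLeft i ≤ arcRight j ∧ arcLeft j ≤ arcRight i ∨ arcLeft i = 0 ∧ arcRight j = 9 ∨
        arcLeft j = 0 ∧ arcRight i = 9 :=
  image_Icc_inter_image_Icc_nonempty_iff (arcLeft_le_arcRight i) (arcRight_le i)
    (arcLeft_le_arcRight j) (arcRight_le j)

theorem exists_isIntervalGraph_pc_eq_three (N : ℕ) :
    ∃ n ≥ N, ∃ (G : SimpleGraph (Fin n)) (_ : DecidableRel G.Adj),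
      G.Connected ∧ IsIntervalGraph G ∧ 2 ≤ G.minDegree ∧ pc G = 3 := by
  classical
  let G : SimpleGraph (Fin (N + 9)) := interGraph fun i => fanInterval i
  have hadj : ∀ i j : Fin (N + 9), G.Adj i j ↔ i.1 ≠ j.1 ∧
      (i.1 = 0 ∨ j.1 = 0 ∨ fanPoint i = fanPoint j) := fun i j => by
    rw [← fanInterval_inter_nonempty_iff, ne_eq, ← Fin.ext_iff]
    rfl
  have hconn : G.Connected := by
    have h0 : ∀ i, G.Reachable i 0 := by
      intro i
      by_cases hi : i = 0
      · rw [hi]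
      · exact ((hadj i 0).2 ⟨fun h => hi (Fin.ext h), by simp⟩).reachable
    exact ⟨fun i j => (h0 i).trans (h0 j).symm⟩
  have hint : IsIntervalGraph G := ⟨fun i => fanInterval i, fun i => fanInterval_mem i,
    fun _ _ => Iff.rfl⟩
  have hdeg : 2 ≤ G.minDegree := by
    refine two_le_minDegree fun i => ?_
    simp only [hadj, fanPoint]
    by_cases h0 : i.1 = 0
    · exact ⟨⟨1, by omega⟩, ⟨2, by omega⟩, by simp, by simp [h0], by simp [h0]⟩
    · by_cases h7 : i.1 < 7
      · obtain ⟨k, hk | hk⟩ := Nat.even_or_odd' i.1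
        · exact ⟨0, ⟨2 * k - 1, by omega⟩, by simp [Fin.ext_iff]; omega, by simp [h0],
            by dsimp only; omega⟩
        · exact ⟨0, ⟨2 * k + 2, by omega⟩, by simp [Fin.ext_iff], by simp [h0],
            by dsimp only; omega⟩
      · by_cases h7' : i.1 = 7
        · exact ⟨0, ⟨8, by omega⟩, by simp [Fin.ext_iff], by simp [h0], by dsimp only; omega⟩
        · exact ⟨0, ⟨7, by omega⟩, by simp [Fin.ext_iff], by simp [h0], by dsimp only; omega⟩
  refine ⟨N + 9, by omega, G, inferInstance, hconn, hint, hdeg,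
    le_antisymm (pc_le_three_of_isIntervalGraph hconn hint hdeg) ?_⟩
  refine three_le_pc (p := 0) (a := fun j => ⟨2 * j + 1, by omega⟩)
    (b := fun j => ⟨2 * j + 2, by omega⟩) (fun j => ⟨?_, ?_, ?_, ?_, ?_⟩) ?_
  all_goals simp only [hadj, fanPoint, Fin.ext_iff, Fin.val_zero, ne_eq]
  · omega
  · simp
  · simp
  · intro x; omega
  · intro x; omega
  · intro i j; omega

theorem exists_isCircularArcGraph_pc_eq_three (N : ℕ) :
    ∃ n ≥ N, ∃ (G : SimpleGraph (Fin n)) (_ : DecidableRel G.Adj),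
      G.Connected ∧ IsCircularArcGraph G ∧ ¬ IsIntervalGraph G ∧ 2 ≤ G.minDegree ∧ pc G = 3 := by
  classical
  let S : Fin (N + 12) → Set UnitAddCircle := fun i =>
    (fun x : ℝ => (x : UnitAddCircle)) '' squareInterval i
  let G : SimpleGraph (Fin (N + 12)) := interGraph S
  have hadj : ∀ i j : Fin (N + 12), G.Adj i j ↔ i.1 ≠ j.1 ∧
      (arcLeft i ≤ arcRight j ∧ arcLeft j ≤ arcRight i ∨ arcLeft i = 0 ∧ arcRight j = 9 ∨
        arcLeft j = 0 ∧ arcRight i = 9) := fun i j => by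
    rw [← squareArc_inter_nonempty_iff, ne_eq, ← Fin.ext_iff]
    rfl
  have h0 : arcLeft 0 = 0 ∧ arcRight 0 = 6 := by decide
  have h1 : arcLeft 1 = 6 ∧ arcRight 1 = 7 := by decide
  have h2 : arcLeft 2 = 7 ∧ arcRight 2 = 8 := by decide
  have h3 : arcLeft 3 = 8 ∧ arcRight 3 = 9 := by decide
  have h4 : ∀ i, 4 ≤ i → arcLeft i = min (i / 2 - 1) 4 ∧ arcRight i = min (i / 2 - 1) 4 := by
    intro i hi
    unfold arcLeft arcRight
    split_ifs <;> omega
  have hcases : ∀ i, i = 0 ∨ i = 1 ∨ i = 2 ∨ i = 3 ∨ 4 ≤ i := fun i => by omega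
  have hadj0 : ∀ i : Fin (N + 12), G.Adj i 0 ↔ i.1 ≠ 0 ∧ i.1 ≠ 2 := by
    intro i
    rw [hadj, Fin.val_zero]
    rcases hcases i.1 with h | h | h | h | h
    · rw [h]; omega
    · rw [h]; omega
    · rw [h]; omega
    · rw [h]; omega
    · have := h4 i h; omega
  let v : Fin 4 → Fin (N + 12) := fun j => ⟨j, by omega⟩
  have h12 : G.Adj (v 1) (v 2) := by
    rw [hadj]; simp only [v]; norm_num; omega
  have h23 : G.Adj (v 2) (v 3) := by
    rw [hadj]; simp only [v]; norm_num; omega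
  have h13 : ¬ G.Adj (v 1) (v 3) := by
    rw [hadj]; simp only [v]; norm_num; omega
  have h10 : G.Adj (v 1) 0 := (hadj0 _).2 (by simp [v])
  have h30 : G.Adj (v 3) 0 := (hadj0 _).2 (by simp [v])
  have h20 : ¬ G.Adj (v 2) 0 := fun h => ((hadj0 _).1 h).2 rfl
  have hconn : G.Connected := by
    have h0 : ∀ i, G.Reachable i 0 := by
      intro i
      by_cases hi : i = 0
      · rw [hi]
      · by_cases hi2 : i.1 = 2
        · rw [show i = v 2 from Fin.ext hi2]
          exact h12.symm.reachable.trans h10.reachable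
        · exact ((hadj0 i).2 ⟨fun h => hi (Fin.ext h), hi2⟩).reachable
    exact ⟨fun i j => (h0 i).trans (h0 j).symm⟩
  have harc : IsCircularArcGraph G :=
    ⟨S, fun i => ⟨_, squareInterval_mem i, rfl⟩, fun _ _ => Iff.rfl⟩
  have hnint : ¬ IsIntervalGraph G := by
    refine not_isIntervalGraph_of_square h10.symm h12 h23 h30 (fun h => h20 h.symm) h13 ?_ ?_ <;>
      simp [v, Fin.ext_iff]
  -- The points come in classes of at least two equal ones.
  have hpoint : ∀ i j : Fin (N + 12), 4 ≤ i.1 → 4 ≤ j.1 →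
      (G.Adj i j ↔ i.1 ≠ j.1 ∧ min (i.1 / 2) 5 = min (j.1 / 2) 5) := by
    intro i j hi hj
    have := h4 i hi
    have := h4 j hj
    rw [hadj]
    omega
  have hdeg : 2 ≤ G.minDegree := by
    refine two_le_minDegree fun i => ?_
    rcases hcases i.1 with h | h | h | h | h
    · rw [show i = 0 from Fin.ext h]
      exact ⟨v 1, v 3, by simp [v], h10.symm, h30.symm⟩
    · rw [show i = v 1 from Fin.ext h]
      exact ⟨0, v 2, by simp [v, Fin.ext_iff], h10, h12⟩
    · rw [show i = v 2 from Fin.ext h]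
      exact ⟨v 1, v 3, by simp [v], h12.symm, h23⟩
    · rw [show i = v 3 from Fin.ext h]
      exact ⟨0, v 2, by simp [v, Fin.ext_iff], h30, h23.symm⟩
    · have hi0 : G.Adj i 0 := (hadj0 i).2 ⟨by omega, by omega⟩
      by_cases h10 : i.1 < 10
      · refine ⟨0, ⟨i.1 + 1 - 2 * (i.1 % 2), by omega⟩, ?_, hi0, (hpoint _ _ h ?_).2 ?_⟩
        · simp [Fin.ext_iff]; omega
        · dsimp only; omega
        · dsimp only; omega
      · by_cases h10' : i.1 = 10
        · exact ⟨0, ⟨11, by omega⟩, by simp [Fin.ext_iff], hi0,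
            (hpoint _ _ h (by simp)).2 (by dsimp only; omega)⟩
        · exact ⟨0, ⟨10, by omega⟩, by simp [Fin.ext_iff], hi0,
            (hpoint _ _ h (by simp)).2 (by dsimp only; omega)⟩
  refine ⟨N + 12, by omega, G, inferInstance, hconn, harc, hnint, hdeg,
    le_antisymm (pc_le_three_of_isCircularArcGraph hconn harc hdeg) ?_⟩
  -- A point has no neighbour among the arcs other than the first and the points.
  have hout : ∀ i x : Fin (N + 12), 4 ≤ i.1 → G.Adj i x → x = 0 ∨ 4 ≤ x.1 := by
    intro i x hi hix
    have := h4 i hi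
    rw [hadj] at hix
    rcases hcases x.1 with h | h | h | h | h
    · exact Or.inl (Fin.ext h)
    · rw [h] at hix; omega
    · rw [h] at hix; omega
    · rw [h] at hix; omega
    · exact Or.inr h
  refine three_le_pc (p := 0) (a := fun j => ⟨2 * j + 4, by omega⟩)
    (b := fun j => ⟨2 * j + 5, by omega⟩) (fun j => ⟨?_, ?_, ?_, ?_, ?_⟩) ?_
  · exact (hpoint _ _ (by simp) (by simp)).2 (by dsimp only; omega)
  · exact (hadj0 _).2 (by simp)
  · exact (hadj0 _).2 (by simp)
  · intro x hx
    refine (hout _ x (by simp) hx).symm.imp_left fun h => Fin.ext ?_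
    have := (hpoint _ x (by simp) h).1 hx
    dsimp only at this ⊢
    omega
  · intro x hx
    refine (hout _ x (by simp) hx).symm.imp_left fun h => Fin.ext ?_
    have := (hpoint _ x (by simp) h).1 hx
    dsimp only at this ⊢
    omega
  · intro i j
    simp only [Fin.ext_iff, ne_eq]
    omega

end ProperConnection

theorem theorem4p2 :
    (∀ (V : Type*) [Fintype V] (G : SimpleGraph V) [DecidableRel G.Adj],
      G.Connected →
      (ProperConnection.IsIntervalGraph G ∨ ProperConnection.IsCircularArcGraph G) →
      2 ≤ G.minDegree →
      ProperConnection.pc G ≤ 3) ∧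
    (∀ N : ℕ, ∃ n ≥ N, ∃ (G : SimpleGraph (Fin n)) (_ : DecidableRel G.Adj),
      G.Connected ∧ ProperConnection.IsIntervalGraph G ∧ 2 ≤ G.minDegree ∧
      ProperConnection.pc G = 3) ∧
    (∀ N : ℕ, ∃ n ≥ N, ∃ (G : SimpleGraph (Fin n)) (_ : DecidableRel G.Adj),
      G.Connected ∧ ProperConnection.IsCircularArcGraph G ∧
      ¬ ProperConnection.IsIntervalGraph G ∧ 2 ≤ G.minDegree ∧
      ProperConnection.pc G = 3) := by
  refine ⟨fun V _ G _ hconn hG hdeg => ?_, ProperConnection.exists_isIntervalGraph_pc_eq_three,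
    ProperConnection.exists_isCircularArcGraph_pc_eq_three⟩
  exact hG.elim (fun h => ProperConnection.pc_le_three_of_isIntervalGraph hconn h hdeg)
    fun h => ProperConnection.pc_le_three_of_isCircularArcGraph hconn h hdeg
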